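/- Let $X\subset\mathbb R^d$ be compact and let $K:X\times X\to\mathbb R$ be a Mercer kernel, i.e. continuous, symmetric and positive semi-definite. Let $P$ and $\rho$ be Borel probability measures on $X$, and for $\mu\in\{P,\rho\}$ let $T_{K,\mu}f(x)=\int_X K(x,y)f(y)\,d\mu(y)$ on $L^2(X,\mu)$. Assume - ($H_0$) $T_{K,P}$ is injective on $L^2(X,P)$; - ($H_1$) $\rho\ll P$ and the density $d\rho/dP$ is ($P$-essentially) bounded. Let $\lambda_1\ge\lambda_2\ge\dots\ge0$ and $\lambda_{1,\rho}\ge\lambda_{2,\rho}\ge\dots\ge 0$ be the eigenvalues of $T_{K,P}$ and $T_{K,\rho}$, repeated according to multiplicity (and continued by zeros if there are only finitely many), and let $(\varphi_j)_{j\ge1}$ be corresponding $P$-orthonormal eigenfunctions, $T_{K,P}\varphi_j=\lambda_j\varphi_j$ (with $\varphi_j=0$ if $L^2(X,P)$ is finite-dimensional and $j>\dim L^2(X,P)$). Put $\|\varphi_j\|_\rho^2=\int_X|\varphi_j|^2\,d\rho$. 1. For every $m\ge1$, the series below converges and $$\lambda_{m,\rho}\le\sum_{j\ge m}\lambda_j\|\varphi_j\|_\rho^2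 .$$ 2. Let $1\le k\le n$, let $X_1,\dots,X_n$ be i.i.d. with law $\rho$, and let $\lambda_1(B_n)\ge\dots\ge\lambda_n(B_n)$ be the eigenvalues of the random Gram matrix $B_n=\frac1n[K(X_i,X_j)]_{1\le i,j\le n}$. Then $\sum_{j=k}^n\lambda_j(B_n)$ is integrable, $\sum_{j\ge k}\lambda_{j,\rho}<\infty$, and $$\mathbb E\Big[\sum_{j=k}^n\lambda_j(B_n)\Big]\le\sum_{j\ge k}\lambda_{j,\rho}.$$ 3. Let $k\ge1$ be such that $\lambda_k\|\varphi_k\|_\rho^2>0$ and $$S_k:=\sum_{i\ge k}\frac{(i-k+1)\,\lambda_i\|\varphi_i\|_\rho^2}{\lambda_k\|\varphi_k\|_\rho^2}<\infty .$$ Then $\sum_{j\ge k}\lambda_{j,\rho}<\infty$ and $$\sum_{j\ge k}\lambda_{j,\rho}\le S_k\,\lambda_k\|\varphi_k\|_\rho^2 ;$$ so the tail sum is $\lesssim\lambda_k\|\varphi_k\|_\rho^2$ with implied constant $S_k$. -/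

import Mathlib

open MeasureTheory ProbabilityTheory Set Filter

namespace KernelSpectrum

section Operator

variable {S : Type*} [PseudoMetricSpace S]

/-- A Mercer kernel: a continuous, symmetric, positive semi-definite real kernel
(symmetry is part of `Matrix.PosSemidef`, which for an arbitrary index type says
that all finite quadratic forms `∑ i, ∑ j, c i * c j * K (x i) (x j)` are nonnegative). -/
structure IsMercerKernel (K : S → S → ℝ) : Prop where
  continuous : Continuous (fun p : S × S => K p.1 p.2)
  posSemidef : (Matrix.of K).PosSemidef

theorem exists_kernel_bound [CompactSpace S] {K : S → S → ℝ} (hK : IsMercerKernel K) :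
    ∃ C : ℝ, ∀ x y, ‖K x y‖ ≤ C := by
  obtain ⟨C, hC⟩ := (isCompact_range hK.continuous.norm).bddAbove
  exact ⟨C, fun x y => hC ⟨(x, y), rfl⟩⟩

theorem integrable_of_L2 {S : Type*} [MeasurableSpace S] {μ : Measure S} [IsFiniteMeasure μ] (f : Lp ℝ 2 μ) :
    Integrable (f : S → ℝ) μ :=
  (Lp.memLp f).integrable (by norm_num)

variable [CompactSpace S] [MeasurableSpace S] [BorelSpace S]

theorem integrable_kernel_mul {K : S → S → ℝ} (hK : IsMercerKernel K) (μ : Measure S)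
    [IsFiniteMeasure μ] (f : Lp ℝ 2 μ) (x : S) :
    Integrable (fun y => K x y * f y) μ := by
  obtain ⟨C, hC⟩ := exists_kernel_bound hK
  have hc : Continuous (fun y => K x y) :=
    hK.continuous.comp (Continuous.prodMk_right x)
  exact (integrable_of_L2 f).bdd_mul (c := C) hc.aestronglyMeasurable
    (Eventually.of_forall fun y => hC x y)

theorem continuous_kernel_integral {K : S → S → ℝ} (hK : IsMercerKernel K) (μ : Measure S)
    [IsFiniteMeasure μ] (f : Lp ℝ 2 μ) :
    Continuous (fun x => ∫ y, K x y * f y ∂μ) := by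
  obtain ⟨C, hC⟩ := exists_kernel_bound hK
  refine continuous_of_dominated (bound := fun y => C * ‖f y‖)
    (fun x => (integrable_kernel_mul hK μ f x).aestronglyMeasurable)
    (fun x => Eventually.of_forall fun y => ?_)
    ((integrable_of_L2 f).norm.const_mul C) (Eventually.of_forall fun y => ?_)
  · rw [norm_mul]
    exact mul_le_mul_of_nonneg_right (hC x y) (norm_nonneg _)
  · exact (hK.continuous.comp (Continuous.prodMk_left y)).mul continuous_const

/-- The kernel integral operator `(T f)(x) = ∫ K(x,y) f(y) dμ(y)` on `L²(S, μ)`. -/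
noncomputable def kernelOp {K : S → S → ℝ} (hK : IsMercerKernel K) (μ : Measure S)
    [IsFiniteMeasure μ] : Module.End ℝ (Lp ℝ 2 μ) where
  toFun f := ContinuousMap.toLp 2 μ ℝ
    ⟨fun x => ∫ y, K x y * f y ∂μ, continuous_kernel_integral hK μ f⟩
  map_add' f g := by
    rw [← map_add]
    congr 1
    ext x
    change ∫ y, K x y * (f + g) y ∂μ = ∫ y, K x y * f y ∂μ + ∫ y, K x y * g y ∂μ
    rw [← integral_add (integrable_kernel_mul hK μ f x) (integrable_kernel_mul hK μ g x)]
    refine integral_congr_ae ?_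
    filter_upwards [Lp.coeFn_add f g] with y hy
    rw [hy, Pi.add_apply, mul_add]
  map_smul' c f := by
    rw [RingHom.id_apply, ← map_smul]
    congr 1
    ext x
    change ∫ y, K x y * (c • f) y ∂μ = c * ∫ y, K x y * f y ∂μ
    rw [← integral_const_mul]
    refine integral_congr_ae ?_
    filter_upwards [Lp.coeFn_smul c f] with y hy
    rw [hy, Pi.smul_apply, smul_eq_mul]
    ring

end Operator

section Eigenvalues

variable {E : Type*}

/-- `a 0 ≥ a 1 ≥ ⋯ ≥ 0` lists the nonzero eigenvalues of `T` in decreasing order, each one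
repeated according to its multiplicity; if there are only finitely many of them (counted with
multiplicity), the list is continued by zeros. -/
structure IsEigenvalueSeq [AddCommGroup E] [Module ℝ E] (T : Module.End ℝ E) (a : ℕ → ℝ) :
    Prop where
  antitone : Antitone a
  nonneg : ∀ j, 0 ≤ a j
  multiplicity : ∀ r : ℝ, r ≠ 0 →
    {j | a j = r}.encard = Cardinal.toENat (Module.rank ℝ (T.eigenspace r))

/-- `a` is the ordered eigenvalue sequence of `T` and `e` a corresponding orthonormal sequence of
eigenvectors. When `T` is injective on an infinite-dimensional space and has an orthonormal basis
of eigenvectors, no `a j` vanishes; in finite dimension the sequence `a` ends with zeros, and then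
`e j` is only required to lie in the kernel of `T`. -/
structure IsEigensystem [NormedAddCommGroup E] [InnerProductSpace ℝ E] (T : Module.End ℝ E)
    (a : ℕ → ℝ) (e : ℕ → E) : Prop where
  eigenvalues : IsEigenvalueSeq T a
  apply_eq : ∀ j, T (e j) = a j • e j
  orthonormal : Orthonormal ℝ (fun j : {j : ℕ // a j ≠ 0} => e j)

end Eigenvalues

section Gram

variable {S : Type*} [PseudoMetricSpace S]

/-- The normalized Gram matrix `(1/n) [K(x i, x j)]`. -/
noncomputable def gramMatrix (K : S → S → ℝ) {n : ℕ} (x : Fin n → S) :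
    Matrix (Fin n) (Fin n) ℝ :=
  Matrix.of fun i j => (1 / (n : ℝ)) * K (x i) (x j)

theorem gramMatrix_isHermitian {K : S → S → ℝ} (hK : IsMercerKernel K) {n : ℕ}
    (x : Fin n → S) : (gramMatrix K x).IsHermitian := by
  ext i j
  have h := hK.posSemidef.1.apply (x i) (x j)
  simp only [Matrix.of_apply, star_trivial] at h
  simp [gramMatrix, h]

/-- The sum of the eigenvalues of the Gram matrix, listed in decreasing order as
`λ_0 ≥ ⋯ ≥ λ_{n-1}` with multiplicity, over the indices `j ≥ k`. -/
noncomputable def gramTail {K : S → S → ℝ} (hK : IsMercerKernel K) {n : ℕ} (x : Fin n → S)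
    (k : ℕ) : ℝ :=
  ∑ j : Fin (Fintype.card (Fin n)),
    if k ≤ (j : ℕ) then (gramMatrix_isHermitian hK x).eigenvalues₀ j else 0

end Gram

/-- `‖f‖²_ρ = ∫ f² dρ`. -/
noncomputable def sqNorm {S : Type*} [MeasurableSpace S] (ρ : Measure S) (f : S → ℝ) : ℝ :=
  ∫ x, f x ^ 2 ∂ρ

end KernelSpectrum

/-! Write K(x, y) = ⟨κ(x), κ(y)⟩ with κ continuous into a Hilbert space H. For each measure μ put
A_μ u = ⟨u, κ(·)⟩ in L²(μ); A_μ is compact and the integral operator is A_μ A_μ*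
(`kernelOp_eq_comp_adjoint`). H does not depend on μ, so P, ρ and the empirical measure of a sample
can all be compared inside it.

Let e_j = λ_j^(-1/2) A_P* φ_j, orthonormal where λ_j ≠ 0 and zero elsewhere. Then A_P e_j = √λ_j
φ_j, and ρ ≪ P turns this into ‖A_ρ e_j‖² = λ_j ‖φ_j‖²_ρ. For the eigenvalue bound
(`le_tsum_norm_sq_featureOp_singularVec`), choose f ≠ 0 in the span of the first m + 1
eigenfunctions for ρ, orthogonal to the m vectors A_ρ e_j with j < m. Then λ_{m,ρ} ‖f‖² ≤ ‖A_ρ* f‖²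
= ∑_{j ≥ m} ⟨A_ρ e_j, f⟩² by Parseval, and Cauchy–Schwarz finishes.

For the Gram matrix, the tail beyond m is the least mean squared residual of the sampled κ(X_l) over
m-term families in H (`gramTail_le_meanResidual`, `exists_gramTail_eq_meanResidual`). Testing with
the first m right singular vectors of A_ρ and taking expectations leaves the trace of the operator
for ρ minus its first m eigenvalues.

The last claim sums the first one over all m ≥ k and exchanges the sums. -/

namespace KernelSpectrum

/-! ### Feature map and factorization of the integral operator -/

section FeatureMap

variable {S : Type*} [PseudoMetricSpace S]

/-- Every Mercer kernel is the Gram kernel of a continuous map into a Hilbert space. -/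
theorem IsMercerKernel.exists_featureMap.{u} {S : Type u} [PseudoMetricSpace S] {K : S → S → ℝ}
    (hK : IsMercerKernel K) :
    ∃ (H : Type u) (_ : NormedAddCommGroup H) (_ : InnerProductSpace ℝ H) (_ : CompleteSpace H)
      (k : C(S, H)), ∀ x y, inner ℝ (k x) (k y) = K x y := by
  -- The RKHS construction takes operator-valued kernels, so scalars become multiples of the
  -- identity of ℝ.
  let M : Matrix S S (ℝ →L[ℝ] ℝ) := Matrix.of fun x y => K x y • ContinuousLinearMap.id ℝ ℝ
  have hsymm : ∀ x y, K x y = K y x := fun x y => by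
    simpa using (hK.posSemidef.1.apply x y).symm
  have hM : M.PosSemidef := by
    refine ((RKHS.posSemidef_tfae (K := M)).out 0 2 rfl rfl).mpr ⟨?_, fun v => ?_⟩
    · ext x y
      simp [M, hsymm x y, ← ContinuousLinearMap.one_def]
    · have h := hK.posSemidef.2 v
      refine h.trans_eq ?_
      simp only [M, Matrix.of_apply, star_trivial, RCLike.re_to_real]
      refine Finsupp.sum_congr fun x _ => Finsupp.sum_congr fun y _ => ?_
      simp [hsymm y x]
      ring
  have : Fact M.PosSemidef := ⟨hM⟩
  let k : S → RKHS.OfKernel M := fun x => RKHS.kerFun (RKHS.OfKernel M) x 1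
  have hk : ∀ x y, inner ℝ (k x) (k y) = K x y := fun x y => by
    have h := RKHS.kernel_inner (RKHS.OfKernel M) y x (1 : ℝ) (1 : ℝ)
    rw [RKHS.OfKernel.kernel_ofKernel] at h
    rw [← h]
    simp [M, hsymm x y, ← ContinuousLinearMap.one_def]
  have hc : Continuous k := by
    rw [continuous_iff_continuousAt]
    intro x
    rw [ContinuousAt, tendsto_iff_norm_sub_tendsto_zero]
    -- Distances between feature vectors are expressed by K alone, so continuity of κ comes from
    -- that of K.
    have h2 : ∀ y, ‖k y - k x‖ = Real.sqrt (K y y - 2 * K y x + K x x) := fun y => by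
      rw [← hk, ← hk, ← hk, real_inner_self_eq_norm_sq, real_inner_self_eq_norm_sq,
        ← norm_sub_sq_real, Real.sqrt_sq (norm_nonneg _)]
    simp_rw [h2]
    have h3 : Continuous fun y => Real.sqrt (K y y - 2 * K y x + K x x) :=
      (((hK.continuous.comp (continuous_id.prodMk continuous_id)).sub
        (continuous_const.mul (hK.continuous.comp (Continuous.prodMk_left x)))).add
          continuous_const).sqrt
    have h4 := h3.tendsto x
    simpa [show K x x - 2 * K x x + K x x = 0 by ring] using h4
  exact ⟨RKHS.OfKernel M, inferInstance, inferInstance, inferInstance, ⟨k, hc⟩, hk⟩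

variable [CompactSpace S] {H : Type*} [NormedAddCommGroup H] [InnerProductSpace ℝ H]

/-- The operator sending `u` to the continuous function `x ↦ ⟪u, k x⟫`. -/
noncomputable def evalOp (k : C(S, H)) : H →L[ℝ] C(S, ℝ) :=
  LinearMap.mkContinuous
    { toFun := fun u => ⟨fun x => inner ℝ u (k x), continuous_const.inner k.continuous⟩
      map_add' := fun u v => by ext x; simp [inner_add_left]
      map_smul' := fun c u => by ext x; simp [inner_smul_left] }
    ‖k‖ fun u => by
      refine (ContinuousMap.norm_le _ (by positivity)).2 fun x => ?_
      calc ‖inner ℝ u (k x)‖ ≤ ‖u‖ * ‖k x‖ := norm_inner_le_norm _ _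
        _ ≤ ‖u‖ * ‖k‖ := by gcongr; exact k.norm_coe_le_norm x
        _ = ‖k‖ * ‖u‖ := mul_comm _ _

@[simp] theorem evalOp_apply (k : C(S, H)) (u : H) (x : S) : evalOp k u x = inner ℝ u (k x) := rfl

/-- Norm limit of finite-rank operators: project u onto the span V of a finite ε/2-net of the
compact range of k. The residual is orthogonal to V, so at x it pairs only with k x - z, z being a
net point near k x. -/
theorem isCompactOperator_evalOp [CompleteSpace H] (k : C(S, H)) :
    IsCompactOperator (evalOp k) := by
  have hcl : evalOp k ∈ closure {f : H →L[ℝ] C(S, ℝ) | IsCompactOperator f} := by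
    refine (Metric.mem_closure_iff (α := H →L[ℝ] C(S, ℝ))).2 fun ε hε => ?_
    obtain ⟨t, ht, hcov⟩ := Metric.totallyBounded_iff.1
      (isCompact_range k.continuous).totallyBounded (ε / 2) (half_pos hε)
    let V := Submodule.span ℝ t
    have : FiniteDimensional ℝ V := FiniteDimensional.span_of_finite ℝ ht
    refine ⟨evalOp k ∘L V.starProjection, ?_, ?_⟩
    · have : ProperSpace V := FiniteDimensional.proper ℝ V
      have h1 : IsCompactOperator (evalOp k ∘L V.subtypeL) :=
        isCompactOperator_of_locallyCompactSpace_rng (evalOp k ∘L V.subtypeL)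
      exact h1.comp_clm V.orthogonalProjectionOnto
    · refine (dist_eq_norm (E := H →L[ℝ] C(S, ℝ)) _ _).trans_lt ?_
      refine (ContinuousLinearMap.opNorm_le_bound _ (half_pos hε).le fun u => ?_).trans_lt
        (half_lt_self hε)
      refine (ContinuousMap.norm_le _ (by positivity)).2 fun x => ?_
      obtain ⟨z, hz, hxz⟩ := mem_iUnion₂.1 (hcov (mem_range_self x))
      have hz0 : inner ℝ (u - V.starProjection u) z = 0 :=
        Submodule.inner_left_of_mem_orthogonal (Submodule.subset_span hz)
          (V.sub_starProjection_mem_orthogonal u)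
      have hu : ‖u - V.starProjection u‖ ≤ ‖u‖ := by
        have := V.norm_sq_eq_add_norm_sq_starProjection u
        rw [V.starProjection_orthogonal_val] at this
        nlinarith [norm_nonneg u, norm_nonneg (u - V.starProjection u),
          sq_nonneg ‖V.starProjection u‖]
      have he : (evalOp k - evalOp k ∘L V.starProjection) u x
          = inner ℝ (u - V.starProjection u) (k x - z) := by
        rw [inner_sub_right, hz0, sub_zero, inner_sub_left]
        simp
      rw [he]
      calc _ ≤ ‖u - V.starProjection u‖ * ‖k x - z‖ := norm_inner_le_norm _ _
        _ ≤ ‖u‖ * (ε / 2) := by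
          gcongr
          rw [← dist_eq_norm]
          exact (Metric.mem_ball.1 hxz).le
        _ = ε / 2 * ‖u‖ := mul_comm _ _
  exact isClosed_setOfPred_isCompactOperator.closure_subset hcl

variable [MeasurableSpace S] [BorelSpace S]

/-- The operator sending `u` to the class of `x ↦ ⟪u, k x⟫` in `L²(μ)`. -/
noncomputable def featureOp (k : C(S, H)) (μ : Measure S) [IsFiniteMeasure μ] :
    H →L[ℝ] Lp ℝ 2 μ :=
  ContinuousMap.toLp 2 μ ℝ ∘L evalOp k

theorem isCompactOperator_featureOp [CompleteSpace H] (k : C(S, H)) (μ : Measure S)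
    [IsFiniteMeasure μ] : IsCompactOperator (featureOp k μ) :=
  (isCompactOperator_evalOp k).clm_comp (ContinuousMap.toLp 2 μ ℝ)

theorem coeFn_featureOp (k : C(S, H)) (μ : Measure S) [IsFiniteMeasure μ] (u : H) :
    featureOp k μ u =ᵐ[μ] fun x => inner ℝ u (k x) :=
  ContinuousMap.coeFn_toLp μ (evalOp k u)

theorem norm_sq_featureOp (k : C(S, H)) (μ : Measure S) [IsFiniteMeasure μ] (u : H) :
    ‖featureOp k μ u‖ ^ 2 = ∫ x, inner ℝ u (k x) ^ 2 ∂μ := by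
  rw [← real_inner_self_eq_norm_sq, L2.inner_def]
  refine integral_congr_ae ?_
  filter_upwards [coeFn_featureOp k μ u] with x hx
  rw [hx, real_inner_self_eq_norm_sq, Real.norm_eq_abs, sq_abs]

theorem featureOp_eq_zero_iff (k : C(S, H)) (μ : Measure S) [IsFiniteMeasure μ] (u : H) :
    featureOp k μ u = 0 ↔ ∀ᵐ x ∂μ, inner ℝ u (k x) = 0 := by
  rw [Lp.eq_zero_iff_ae_eq_zero]
  exact ⟨fun h => (coeFn_featureOp k μ u).symm.trans h, fun h => (coeFn_featureOp k μ u).trans h⟩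

theorem inner_adjoint_featureOp [CompleteSpace H] (k : C(S, H)) (μ : Measure S)
    [IsFiniteMeasure μ] (f : Lp ℝ 2 μ) (x : S) :
    inner ℝ ((featureOp k μ).adjoint f) (k x) = ∫ y, inner ℝ (k x) (k y) * f y ∂μ := by
  rw [ContinuousLinearMap.adjoint_inner_left, L2.inner_def]
  refine integral_congr_ae ?_
  filter_upwards [coeFn_featureOp k μ (k x)] with y hy
  rw [hy]
  simp

theorem kernelOp_eq_comp_adjoint [CompleteSpace H] {K : S → S → ℝ} (hK : IsMercerKernel K)
    {k : C(S, H)} (hk : ∀ x y, inner ℝ (k x) (k y) = K x y) (μ : Measure S) [IsFiniteMeasure μ] :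
    kernelOp hK μ = (featureOp k μ ∘L (featureOp k μ).adjoint : Lp ℝ 2 μ →L[ℝ] Lp ℝ 2 μ) := by
  ext1 f
  change ContinuousMap.toLp 2 μ ℝ _ = ContinuousMap.toLp 2 μ ℝ (evalOp k _)
  congr 1
  ext x
  simp [inner_adjoint_featureOp, hk]

end FeatureMap

/-! ### Eigensystems of compact symmetric operators -/

section Spectral

variable {F : Type*} [NormedAddCommGroup F] [InnerProductSpace ℝ F] [CompleteSpace F]
  {T : F →L[ℝ] F} {a : ℕ → ℝ}

theorem IsEigenvalueSeq.encard_eq_finrank (hT : IsCompactOperator T)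
    (ha : IsEigenvalueSeq (T : Module.End ℝ F) a) {r : ℝ} (hr : r ≠ 0) :
    {j | a j = r}.encard = Module.finrank ℝ (Module.End.eigenspace (T : Module.End ℝ F) r) := by
  have := T.finite_dimensional_eigenspace hT r hr
  rw [ha.multiplicity r hr, ← Module.finrank_eq_rank, Cardinal.toENat_nat]

theorem IsEigenvalueSeq.finite_setOf_eq (hT : IsCompactOperator T)
    (ha : IsEigenvalueSeq (T : Module.End ℝ F) a) {r : ℝ} (hr : r ≠ 0) :
    {j | a j = r}.Finite :=
  finite_of_encard_eq_coe (ha.encard_eq_finrank hT hr)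

theorem IsEigenvalueSeq.natCard_eq_finrank (hT : IsCompactOperator T)
    (ha : IsEigenvalueSeq (T : Module.End ℝ F) a) {r : ℝ} (hr : r ≠ 0) :
    Nat.card {j // a j = r} =
      Module.finrank ℝ (Module.End.eigenspace (T : Module.End ℝ F) r) := by
  have h := ha.encard_eq_finrank hT hr
  rw [← (ha.finite_setOf_eq hT hr).cast_ncard_eq, Nat.cast_inj] at h
  rw [← h]
  rfl

/-- The indices carrying a nonzero value r are as many as the dimension of its eigenspace, so they
can label an orthonormal basis of it; symmetry makes distinct eigenspaces orthogonal. -/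
theorem IsEigenvalueSeq.exists_isEigensystem (hT : IsCompactOperator T)
    (hs : T.IsSymmetric) (ha : IsEigenvalueSeq (T : Module.End ℝ F) a) :
    ∃ e : ℕ → F, IsEigensystem (T : Module.End ℝ F) a e := by
  have key : ∀ r : ℝ, r ≠ 0 → ∃ v : {j // a j = r} → F, Orthonormal ℝ v ∧
      ∀ j, v j ∈ Module.End.eigenspace (T : Module.End ℝ F) r := fun r hr => by
    have := T.finite_dimensional_eigenspace hT r hr
    have : Finite {j // a j = r} := ha.finite_setOf_eq hT hr
    let b := stdOrthonormalBasis ℝ (Module.End.eigenspace (T : Module.End ℝ F) r)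
    let q := Finite.equivFinOfCardEq (ha.natCard_eq_finrank hT hr)
    refine ⟨fun j => b (q j), ?_, fun j => (b (q j)).2⟩
    exact (b.orthonormal.comp q q.injective).comp_linearIsometry (Submodule.subtypeₗᵢ _)
  choose v hv hv' using key
  let e : ℕ → F := fun j => if h : a j = 0 then 0 else v (a j) h ⟨j, rfl⟩
  have he : ∀ j, ∀ (h : a j ≠ 0), e j = v (a j) h ⟨j, rfl⟩ := fun j h => dif_neg h
  have he' : ∀ j r (h : r ≠ 0) (hj : a j = r), e j = v r h ⟨j, hj⟩ := by
    rintro j r h rfl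
    exact he j h
  refine ⟨e, ha, fun j => ?_, fun j => ?_, ?_⟩
  · by_cases h : a j = 0
    · simp [e, h]
    · rw [he j h]
      exact Module.End.mem_eigenspace_iff.1 (hv' (a j) h ⟨j, rfl⟩)
  · change ‖e j‖ = 1
    rw [he j j.2]
    exact (hv _ _).1 _
  · rintro ⟨i, hi⟩ ⟨j, hj⟩ hij
    have hij : i ≠ j := fun h => hij (Subtype.ext h)
    change inner ℝ (e i) (e j) = 0
    by_cases h : a i = a j
    · rw [he' i (a j) hj h, he' j (a j) hj rfl]
      exact (hv _ hj).2 (fun h => hij (congrArg Subtype.val h))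
    · rw [he i hi, he j hj]
      exact hs.orthogonalFamily_eigenspaces.pairwise (Ne.symm h) (hv' _ hj _) _ (hv' _ hi _)

/-- Dimension count: the multiplicity condition supplies as many orthonormal eigenvectors as the
eigenspace has dimensions. -/
theorem IsEigensystem.eigenspace_le_span {e : ℕ → F} (hT : IsCompactOperator T)
    (h : IsEigensystem (T : Module.End ℝ F) a e) {r : ℝ} (hr : r ≠ 0) :
    Module.End.eigenspace (T : Module.End ℝ F) r ≤
      Submodule.span ℝ (range fun j : {j // a j = r} => e j) := by
  have := T.finite_dimensional_eigenspace hT r hr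
  have : Finite {j // a j = r} := h.eigenvalues.finite_setOf_eq hT hr
  have := Fintype.ofFinite {j // a j = r}
  have ho : Orthonormal ℝ fun j : {j // a j = r} => e j :=
    h.orthonormal.comp (fun j : {j // a j = r} => ⟨j, by rw [j.2]; exact hr⟩)
      fun i j hij => Subtype.ext (congrArg Subtype.val hij :)
  refine (Submodule.eq_of_le_of_finrank_eq ?_ ?_).ge
  · rw [Submodule.span_le]
    rintro _ ⟨j, rfl⟩
    refine Module.End.mem_eigenspace_iff.2 ?_
    rw [h.apply_eq, j.2]
  · rw [finrank_span_eq_card ho.linearIndependent, ← h.eigenvalues.natCard_eq_finrank hT hr,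
      Nat.card_eq_fintype_card]

/-- A vector orthogonal to an eigensystem of a compact symmetric operator lies in its kernel. -/
theorem IsEigensystem.apply_eq_zero {e : ℕ → F} (hT : IsCompactOperator T) (hs : T.IsSymmetric)
    (h : IsEigensystem (T : Module.End ℝ F) a e) {f : F}
    (hf : ∀ j, a j ≠ 0 → inner ℝ (e j) f = 0) : T f = 0 := by
  have hf' : ∀ r : ℝ, r ≠ 0 → ∀ v ∈ Module.End.eigenspace (T : Module.End ℝ F) r,
      inner ℝ v f = 0 := fun r hr v hv => by
    have hle : Submodule.span ℝ (range fun j : {j // a j = r} => e j) ≤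
        (Submodule.span ℝ {f})ᗮ := by
      rw [Submodule.span_le]
      rintro _ ⟨j, rfl⟩
      exact Submodule.mem_orthogonal_singleton_iff_inner_left.2 (hf j (by rw [j.2]; exact hr))
    exact Submodule.mem_orthogonal_singleton_iff_inner_left.1
      (hle (h.eigenspace_le_span hT hr hv))
  let N := Module.End.eigenspace (T : Module.End ℝ F) 0
  have hN : ∀ x, x ∈ N ↔ T x = 0 := fun x => by
    rw [Module.End.mem_eigenspace_iff, zero_smul]
    rfl
  have hcl : IsClosed (N : Set F) := by
    have : (N : Set F) = {x | T x = 0} := Set.ext hN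
    rw [this]
    exact isClosed_eq T.continuous continuous_const
  have : CompleteSpace N := hcl.completeSpace_coe
  -- Minus its kernel component, f is orthogonal to every eigenspace, hence zero by the spectral
  -- theorem.
  have hg : f - N.starProjection f ∈
      (⨆ r, Module.End.eigenspace (T : Module.End ℝ F) r)ᗮ := by
    rw [← Submodule.iInf_orthogonal, Submodule.mem_iInf]
    intro r
    rcases eq_or_ne r 0 with rfl | hr
    · exact N.sub_starProjection_mem_orthogonal f
    · refine (Submodule.mem_orthogonal _ _).2 fun v hv => ?_
      rw [inner_sub_right, hf' r hr v hv, zero_sub, neg_eq_zero]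
      exact hs.orthogonalFamily_eigenspaces.pairwise hr.symm (N.starProjection_apply_mem f) _ hv
  rw [T.orthogonalComplement_iSup_eigenspaces_eq_bot hT hs, Submodule.mem_bot, sub_eq_zero] at hg
  rw [← hN, hg]
  exact N.starProjection_apply_mem f

end Spectral

/-! ### Bessel's inequality when zero vectors are allowed -/

section SubOrthonormal

variable {H : Type*} [NormedAddCommGroup H] [InnerProductSpace ℝ H] {ι : Type*}

/-- A family of pairwise orthogonal vectors of norm at most one. -/
structure IsSubOrthonormal (e : ι → H) : Prop where
  inner_eq_zero : ∀ i j, i ≠ j → inner ℝ (e i) (e j) = 0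
  norm_le_one : ∀ i, ‖e i‖ ≤ 1

theorem IsSubOrthonormal.sum_inner_sq_le {e : ι → H} (he : IsSubOrthonormal e) (s : Finset ι)
    (u : H) : ∑ j ∈ s, inner ℝ (e j) u ^ 2 ≤ ‖u‖ ^ 2 := by
  set p := ∑ j ∈ s, inner ℝ (e j) u • e j with hp
  have h1 : inner ℝ u p = ∑ j ∈ s, inner ℝ (e j) u ^ 2 := by
    rw [hp, inner_sum]
    refine Finset.sum_congr rfl fun j _ => ?_
    rw [real_inner_smul_right, real_inner_comm, sq]
  have h2 : inner ℝ p p ≤ ∑ j ∈ s, inner ℝ (e j) u ^ 2 := by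
    nth_rewrite 1 [hp]
    rw [sum_inner]
    refine Finset.sum_le_sum fun j hj => ?_
    rw [real_inner_smul_left, hp, inner_sum, Finset.sum_eq_single_of_mem j hj]
    · rw [real_inner_smul_right, real_inner_self_eq_norm_sq]
      have := he.norm_le_one j
      have h3 : ‖e j‖ ^ 2 ≤ 1 := by nlinarith [norm_nonneg (e j)]
      nlinarith [sq_nonneg (inner ℝ (e j) u)]
    · intro i _ hij
      rw [real_inner_smul_right, he.inner_eq_zero j i hij.symm, mul_zero]
  have h3 := norm_sub_sq_real u p
  rw [← real_inner_self_eq_norm_sq p] at h3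
  nlinarith [sq_nonneg ‖u - p‖]

theorem IsSubOrthonormal.comp {e : ι → H} (he : IsSubOrthonormal e) {κ : Type*} {g : κ → ι}
    (hg : Function.Injective g) : IsSubOrthonormal (e ∘ g) :=
  ⟨fun _ _ h => he.inner_eq_zero _ _ (hg.ne h), fun _ => he.norm_le_one _⟩

end SubOrthonormal

/-! ### Right singular vectors -/

section SingularVectors

variable {H F : Type*} [NormedAddCommGroup H] [InnerProductSpace ℝ H] [CompleteSpace H]
  [NormedAddCommGroup F] [InnerProductSpace ℝ F] [CompleteSpace F]
  {A : H →L[ℝ] F} {a : ℕ → ℝ} {φ : ℕ → F}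

/-- The right singular vectors of `A` associated with an eigensystem of `A A*`; they vanish where
the eigenvalue does. -/
noncomputable def singularVec (A : H →L[ℝ] F) (a : ℕ → ℝ) (φ : ℕ → F) (j : ℕ) : H :=
  (Real.sqrt (a j))⁻¹ • A.adjoint (φ j)

theorem singularVec_eq_zero {j : ℕ} (hj : a j = 0) : singularVec A a φ j = 0 := by
  simp [singularVec, hj]

theorem isSymmetric_comp_adjoint (A : H →L[ℝ] F) : (A ∘L A.adjoint).IsSymmetric := fun f g => by
  change inner ℝ (A (A.adjoint f)) g = inner ℝ f (A (A.adjoint g))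
  rw [← A.adjoint_inner_right, A.adjoint_inner_left]

variable (h : IsEigensystem (A ∘L A.adjoint : F →L[ℝ] F) a φ)
include h

theorem IsEigensystem.apply_singularVec (j : ℕ) :
    A (singularVec A a φ j) = Real.sqrt (a j) • φ j := by
  have h1 : A (A.adjoint (φ j)) = a j • φ j := h.apply_eq j
  rcases eq_or_ne (a j) 0 with h0 | h0
  · simp [singularVec_eq_zero h0, h0]
  · rw [singularVec, map_smul, h1, smul_smul]
    congr 1
    have h2 := Real.mul_self_sqrt (h.eigenvalues.nonneg j)
    have h3 : Real.sqrt (a j) ≠ 0 := fun h3 => h0 (by rw [← h2, h3, mul_zero])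
    field_simp
    nlinarith

theorem IsEigensystem.norm_sq_apply_singularVec (j : ℕ) : ‖A (singularVec A a φ j)‖ ^ 2 = a j := by
  rw [h.apply_singularVec]
  rcases eq_or_ne (a j) 0 with h0 | h0
  · simp [h0]
  · rw [norm_smul, show ‖φ j‖ = 1 from h.orthonormal.1 ⟨j, h0⟩, mul_one, Real.norm_eq_abs, sq_abs,
      Real.sq_sqrt (h.eigenvalues.nonneg j)]

theorem IsEigensystem.inner_singularVec {i j : ℕ} (hi : a i ≠ 0) (hj : a j ≠ 0) :
    inner ℝ (singularVec A a φ i) (singularVec A a φ j) = inner ℝ (φ i) (φ j) := by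
  nth_rewrite 1 [singularVec]
  rw [real_inner_smul_left, A.adjoint_inner_left, h.apply_singularVec, real_inner_smul_right]
  by_cases hij : i = j
  · subst hij
    rw [← mul_assoc, inv_mul_cancel₀, one_mul]
    exact Real.sqrt_ne_zero'.2 ((h.eigenvalues.nonneg i).lt_of_ne' hi)
  · have := h.orthonormal.2 (i := ⟨i, hi⟩) (j := ⟨j, hj⟩) (fun hh => hij (congrArg Subtype.val hh))
    rw [show inner ℝ (φ i) (φ j) = 0 from this]
    simp

theorem IsEigensystem.orthonormal_singularVec :
    Orthonormal ℝ fun j : {j // a j ≠ 0} => singularVec A a φ j := by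
  classical
  rw [orthonormal_iff_ite]
  intro i j
  rw [h.inner_singularVec i.2 j.2]
  exact orthonormal_iff_ite.1 h.orthonormal i j

theorem IsEigensystem.isSubOrthonormal_singularVec : IsSubOrthonormal (singularVec A a φ) where
  inner_eq_zero i j hij := by
    by_cases hi : a i = 0
    · rw [singularVec_eq_zero hi, inner_zero_left]
    by_cases hj : a j = 0
    · rw [singularVec_eq_zero hj, inner_zero_right]
    exact h.orthonormal_singularVec.2 (i := ⟨i, hi⟩) (j := ⟨j, hj⟩)
      fun hh => hij (congrArg Subtype.val hh)
  norm_le_one i := by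
    by_cases hi : a i = 0
    · rw [singularVec_eq_zero hi, norm_zero]
      exact zero_le_one
    · exact (h.orthonormal_singularVec.1 ⟨i, hi⟩).le

/-- Orthogonality to the singular vectors says that A w is orthogonal to the eigenvectors of A A*,
so A A* A w = 0; pairing twice removes A and then A*. -/
theorem IsEigensystem.apply_eq_zero_of_inner_singularVec (hA : IsCompactOperator A) {w : H}
    (hw : ∀ j, a j ≠ 0 → inner ℝ (singularVec A a φ j) w = 0) : A w = 0 := by
  have h1 : A (A.adjoint (A w)) = 0 :=
    h.apply_eq_zero (hA.comp_clm A.adjoint) (isSymmetric_comp_adjoint A) fun j hj => by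
      have h2 := hw j hj
      rw [singularVec, real_inner_smul_left, A.adjoint_inner_left] at h2
      exact (mul_eq_zero.1 h2).resolve_left
        (inv_ne_zero (Real.sqrt_ne_zero'.2 ((h.eigenvalues.nonneg j).lt_of_ne' hj)))
  have h2 : inner ℝ (A.adjoint (A w)) (A.adjoint (A w)) = 0 := by
    rw [A.adjoint_inner_left, h1, inner_zero_right]
  rw [inner_self_eq_zero] at h2
  have h3 : inner ℝ (A w) (A w) = 0 := by
    rw [← A.adjoint_inner_left, h2, inner_zero_left]
  exact inner_self_eq_zero.1 h3

/-- Parseval's identity for the right singular vectors of a compact operator. -/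
theorem IsEigensystem.hasSum_inner_singularVec_sq (hA : IsCompactOperator A) {u : H}
    (hu : ∀ w, A w = 0 → inner ℝ w u = 0) :
    HasSum (fun j => inner ℝ (singularVec A a φ j) u ^ 2) (‖u‖ ^ 2) := by
  have ho := h.orthonormal_singularVec
  obtain ⟨w, b, hw, hb⟩ := ho.toSubtypeRange.exists_hilbertBasis_extension
  have hs := b.hasSum_inner_mul_inner u u
  rw [real_inner_self_eq_norm_sq] at hs
  let g : {j // a j ≠ 0} → w := fun j => ⟨singularVec A a φ j, hw (mem_range_self j)⟩
  have hg : Function.Injective g := fun i j hij =>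
    ho.linearIndependent.injective (congrArg Subtype.val hij)
  rw [← hg.hasSum_iff] at hs
  · have hsupp : Function.support (fun j => inner ℝ (singularVec A a φ j) u ^ 2) ⊆
        {j | a j ≠ 0} := fun j hj h0 => hj (by simp [singularVec_eq_zero h0])
    rw [← hasSum_subtype_iff_of_support_subset hsupp]
    refine (congrArg (HasSum · (‖u‖ ^ 2)) (funext fun j => ?_)).mpr hs
    simp [g, hb, real_inner_comm u, sq]
  -- The basis vectors added by the extension lie in the kernel of A, to which u is orthogonal.
  · intro v hv
    have : inner ℝ (b v) u = 0 := by
      refine hu _ (h.apply_eq_zero_of_inner_singularVec hA fun j hj => ?_)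
      have hne : g ⟨j, hj⟩ ≠ v := fun hh => hv ⟨_, hh⟩
      have := b.orthonormal.2 hne
      rwa [hb] at this ⊢
    rw [this, mul_zero]

end SingularVectors

/-! ### Comparison of the spectra for P and ρ; trace formula -/

section Comparison

/-- The Courant–Fischer dimension count: the first `m + 1` eigenvectors span a vector orthogonal
to `m` prescribed ones. -/
theorem IsEigensystem.exists_orthogonal_mul_norm_sq_le {F : Type*} [NormedAddCommGroup F]
    [InnerProductSpace ℝ F] {T : Module.End ℝ F} {a : ℕ → ℝ} {e : ℕ → F}
    (h : IsEigensystem T a e) {m : ℕ} (hm : a m ≠ 0) (d : Fin m → F) :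
    ∃ f : F, f ≠ 0 ∧ (∀ j, inner ℝ (d j) f = 0) ∧ a m * ‖f‖ ^ 2 ≤ inner ℝ (T f) f := by
  have hge : ∀ i : Fin (m + 1), a m ≤ a i := fun i => h.eigenvalues.antitone (by omega)
  have hpos : 0 < a m := (h.eigenvalues.nonneg m).lt_of_ne' hm
  let v : Fin (m + 1) → F := fun i => e i
  have hv : Orthonormal ℝ v :=
    h.orthonormal.comp (fun i : Fin (m + 1) => ⟨i, (hpos.trans_le (hge i)).ne'⟩)
      fun i j hij => Fin.ext (congrArg Subtype.val hij :)
  -- These are m linear conditions on m + 1 coefficients, so a nonzero solution exists.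
  let L : (Fin (m + 1) → ℝ) →ₗ[ℝ] (Fin m → ℝ) :=
    LinearMap.pi fun j => (innerₛₗ ℝ (d j)) ∘ₗ Fintype.linearCombination ℝ v
  have hker : LinearMap.ker L ≠ ⊥ := LinearMap.ker_ne_bot_of_finrank_lt (by simp)
  obtain ⟨c, hc, hc0⟩ := Submodule.exists_mem_ne_zero_of_ne_bot hker
  have hcv : Fintype.linearCombination ℝ v c = ∑ i, c i • v i :=
    Fintype.linearCombination_apply ℝ v c
  refine ⟨∑ i, c i • v i, ?_, fun j => ?_, ?_⟩
  · intro h0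
    refine hc0 (funext fun i => ?_)
    exact Fintype.linearIndependent_iff.1 hv.linearIndependent c h0 i
  · have := congrFun (LinearMap.mem_ker.1 hc) j
    rw [← hcv]
    exact this
  · have hT : T (∑ i, c i • v i) =
        ∑ i : Fin (m + 1), (a i * c i) • v i := by
      rw [map_sum]
      refine Finset.sum_congr rfl fun i _ => ?_
      rw [map_smul, h.apply_eq, smul_smul, mul_comm]
    rw [← real_inner_self_eq_norm_sq, hT, hv.inner_sum, hv.inner_sum, Finset.mul_sum]
    refine Finset.sum_le_sum fun i _ => ?_
    simp only [conj_trivial]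
    nlinarith [hge i, mul_self_nonneg (c i)]

variable {S : Type*} [PseudoMetricSpace S] [CompactSpace S] [MeasurableSpace S] [BorelSpace S]
  {H : Type*} [NormedAddCommGroup H] [InnerProductSpace ℝ H] {k : C(S, H)}

theorem integrable_of_continuous {f : S → ℝ} (hf : Continuous f) (μ : Measure S)
    [IsFiniteMeasure μ] : Integrable f μ := by
  obtain ⟨C, hC⟩ := (isCompact_range hf.norm).bddAbove
  exact Integrable.of_bound hf.aestronglyMeasurable C
    (Eventually.of_forall fun x => hC ⟨x, rfl⟩)

theorem integrable_inner_sq (u : H) (μ : Measure S) [IsFiniteMeasure μ] :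
    Integrable (fun x => inner ℝ u (k x) ^ 2) μ :=
  integrable_of_continuous ((continuous_const.inner k.continuous).pow 2) μ

/-- Bessel's inequality for k x, integrated over x. The bound does not depend on s, whence all the
summability. -/
theorem IsSubOrthonormal.sum_norm_sq_featureOp_le {ι : Type*} {e : ι → H}
    (he : IsSubOrthonormal e) (μ : Measure S) [IsFiniteMeasure μ] (s : Finset ι) :
    ∑ j ∈ s, ‖featureOp k μ (e j)‖ ^ 2 ≤ ∫ x, ‖k x‖ ^ 2 ∂μ := by
  simp_rw [norm_sq_featureOp]
  rw [← integral_finsetSum _ fun j _ => integrable_inner_sq (e j) μ]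
  exact integral_mono (integrable_finsetSum _ fun j _ => integrable_inner_sq (e j) μ)
    (integrable_of_continuous (k.continuous.norm.pow 2) μ) fun x => he.sum_inner_sq_le s (k x)

theorem IsSubOrthonormal.summable_norm_sq_featureOp {ι : Type*} {e : ι → H}
    (he : IsSubOrthonormal e) (μ : Measure S) [IsFiniteMeasure μ] :
    Summable fun j => ‖featureOp k μ (e j)‖ ^ 2 :=
  summable_of_sum_le (fun _ => by positivity) fun s => he.sum_norm_sq_featureOp_le μ s

variable [CompleteSpace H] {P ρ : Measure S} [IsFiniteMeasure P] [IsFiniteMeasure ρ]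
  {lam lamρ : ℕ → ℝ} {phi : ℕ → Lp ℝ 2 P} {psi : ℕ → Lp ℝ 2 ρ}

theorem IsEigensystem.norm_sq_featureOp_singularVec
    (h : IsEigensystem (featureOp k P ∘L (featureOp k P).adjoint : Lp ℝ 2 P →L[ℝ] Lp ℝ 2 P) lam phi)
    (hρP : ρ ≪ P) (j : ℕ) :
    ‖featureOp k ρ (singularVec (featureOp k P) lam phi j)‖ ^ 2 =
      lam j * sqNorm ρ (phi j) := by
  rw [norm_sq_featureOp, sqNorm, ← integral_const_mul]
  have h1 := coeFn_featureOp k P (singularVec (featureOp k P) lam phi j)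
  rw [h.apply_singularVec] at h1
  refine integral_congr_ae (hρP.ae_le ?_)
  filter_upwards [h1, Lp.coeFn_smul (Real.sqrt (lam j)) (phi j)] with x hx hx2
  rw [← hx, hx2, Pi.smul_apply, smul_eq_mul, mul_pow, Real.sq_sqrt (h.eigenvalues.nonneg j)]

/-- Absolute continuity gives ker A_P ⊆ ker A_ρ, so the range of A_ρ* is orthogonal to ker A_P; this
is what Parseval needs. -/
theorem inner_adjoint_featureOp_eq_zero (hρP : ρ ≪ P) (f : Lp ℝ 2 ρ) {w : H}
    (hw : featureOp k P w = 0) : inner ℝ w ((featureOp k ρ).adjoint f) = 0 := by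
  rw [ContinuousLinearMap.adjoint_inner_right,
    (featureOp_eq_zero_iff k ρ w).2 (hρP.ae_le ((featureOp_eq_zero_iff k P w).1 hw)),
    inner_zero_left]

theorem IsEigensystem.le_tsum_norm_sq_featureOp_singularVec
    (h : IsEigensystem (featureOp k P ∘L (featureOp k P).adjoint : Lp ℝ 2 P →L[ℝ] Lp ℝ 2 P) lam phi)
    (h' : IsEigensystem (featureOp k ρ ∘L (featureOp k ρ).adjoint : Lp ℝ 2 ρ →L[ℝ] Lp ℝ 2 ρ)
      lamρ psi) (hρP : ρ ≪ P) (m : ℕ) :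
    lamρ m ≤ ∑' j, ‖featureOp k ρ (singularVec (featureOp k P) lam phi (m + j))‖ ^ 2 := by
  set e := singularVec (featureOp k P) lam phi with he
  have hsum : Summable fun j => ‖featureOp k ρ (e (m + j))‖ ^ 2 :=
    (h.isSubOrthonormal_singularVec.comp (add_right_injective m)).summable_norm_sq_featureOp ρ
  rcases eq_or_ne (lamρ m) 0 with h0 | h0
  · rw [h0]
    exact tsum_nonneg fun j => by positivity
  obtain ⟨f, hf0, hf, hle⟩ :=
    h'.exists_orthogonal_mul_norm_sq_le h0 fun j : Fin m => featureOp k ρ (e j)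
  have hT : inner ℝ ((featureOp k ρ ∘L (featureOp k ρ).adjoint) f) f =
      ‖(featureOp k ρ).adjoint f‖ ^ 2 := by
    rw [← real_inner_self_eq_norm_sq, ContinuousLinearMap.adjoint_inner_right]
    rfl
  have hpars : HasSum (fun j => inner ℝ (featureOp k ρ (e j)) f ^ 2)
      (‖(featureOp k ρ).adjoint f‖ ^ 2) := by
    have := h.hasSum_inner_singularVec_sq (isCompactOperator_featureOp k P)
      (u := (featureOp k ρ).adjoint f) fun w hw => inner_adjoint_featureOp_eq_zero hρP f hw
    simpa only [ContinuousLinearMap.adjoint_inner_right] using this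
  have htail : ‖(featureOp k ρ).adjoint f‖ ^ 2 =
      ∑' j, inner ℝ (featureOp k ρ (e (m + j))) f ^ 2 := by
    rw [← hpars.tsum_eq, ← hpars.summable.sum_add_tsum_nat_add m, Finset.sum_eq_zero, zero_add]
    · simp_rw [add_comm m]
    · intro j hj
      rw [hf ⟨j, Finset.mem_range.1 hj⟩, sq, mul_zero]
  have hbound : ‖(featureOp k ρ).adjoint f‖ ^ 2 ≤
      (∑' j, ‖featureOp k ρ (e (m + j))‖ ^ 2) * ‖f‖ ^ 2 := by
    rw [htail, ← tsum_mul_right]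
    refine (hpars.summable.comp_injective (add_right_injective m)).tsum_le_tsum (fun j => ?_)
      (hsum.mul_right _)
    rw [← mul_pow, ← sq_abs]
    exact pow_le_pow_left₀ (abs_nonneg _) (abs_real_inner_le_norm _ _) 2
  have hfpos : 0 < ‖f‖ ^ 2 := by positivity
  refine le_of_mul_le_mul_right (hle.trans ?_) hfpos
  exact hT.trans_le hbound

/-- The pointwise Mercer expansion on the diagonal, at points of the support of the measure. -/
theorem IsEigensystem.hasSum_inner_singularVec_feature_sq
    (h : IsEigensystem (featureOp k P ∘L (featureOp k P).adjoint : Lp ℝ 2 P →L[ℝ] Lp ℝ 2 P) lam phi)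
    {x : S} (hx : x ∈ P.support) :
    HasSum (fun j => inner ℝ (singularVec (featureOp k P) lam phi j) (k x) ^ 2) (‖k x‖ ^ 2) := by
  refine h.hasSum_inner_singularVec_sq (isCompactOperator_featureOp k P) fun w hw => ?_
  -- Otherwise a neighbourhood of a support point would be P-null, since A_P w = 0.
  by_contra hne
  have hopen : IsOpen {y | inner ℝ w (k y) ≠ 0} :=
    isOpen_ne_fun (continuous_const.inner k.continuous) continuous_const
  have h1 := (Measure.mem_support_iff_forall x).1 hx _ (hopen.mem_nhds hne)
  exact h1.ne' (ae_iff.1 ((featureOp_eq_zero_iff k P w).1 hw))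

/-- The trace formula for the kernel operator. -/
theorem IsEigensystem.hasSum_eigenvalues
    (h : IsEigensystem (featureOp k P ∘L (featureOp k P).adjoint : Lp ℝ 2 P →L[ℝ] Lp ℝ 2 P)
      lam phi) :
    HasSum lam (∫ x, ‖k x‖ ^ 2 ∂P) := by
  have h1 : ∀ j, ∫ x, inner ℝ (singularVec (featureOp k P) lam phi j) (k x) ^ 2 ∂P = lam j :=
    fun j => by rw [← norm_sq_featureOp, h.norm_sq_apply_singularVec]
  have h2 : Summable lam := by
    have := h.isSubOrthonormal_singularVec.summable_norm_sq_featureOp (k := k) P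
    simpa only [h.norm_sq_apply_singularVec] using this
  have h3 := hasSum_integral_of_summable_integral_norm
    (F := fun j x => inner ℝ (singularVec (featureOp k P) lam phi j) (k x) ^ 2) (μ := P)
    (fun j => integrable_inner_sq _ P) (by simpa [h1] using h2)
  simp only [h1] at h3
  have h4 : ∫ x, ∑' j, inner ℝ (singularVec (featureOp k P) lam phi j) (k x) ^ 2 ∂P =
      ∫ x, ‖k x‖ ^ 2 ∂P := by
    refine integral_congr_ae ?_
    filter_upwards [P.support_mem_ae] with x hx
    exact (h.hasSum_inner_singularVec_feature_sq hx).tsum_eq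
  rwa [h4] at h3

end Comparison

/-! ### Summing the tail bounds -/

section TailSums

/-- If each term of `b` is bounded by a tail of `a`, then tail sums of `b` are bounded by
weighted tail sums of `a`. -/
theorem summable_and_tsum_le_of_le_tail {a b : ℕ → ℝ} (ha : ∀ j, 0 ≤ a j) (hb : ∀ j, 0 ≤ b j)
    (hab : ∀ m, b m ≤ ∑' j, a (m + j)) (k : ℕ)
    (hs : Summable fun i : ℕ => ((i : ℝ) + 1) * a (k + i)) :
    Summable (fun j => b (k + j)) ∧
      ∑' j, b (k + j) ≤ ∑' i : ℕ, ((i : ℝ) + 1) * a (k + i) := by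
  have hka : Summable fun i => a (k + i) :=
    hs.of_nonneg_of_le (fun i => ha _) fun i => by
      nlinarith [ha (k + i), (Nat.cast_nonneg i : (0 : ℝ) ≤ i)]
  have key : ∀ N, ∑ j ∈ Finset.range N, b (k + j) ≤ ∑' i : ℕ, ((i : ℝ) + 1) * a (k + i) := by
    intro N
    have htail : ∀ j, ∑' i, a (k + j + i) = ∑' i, if j ≤ i then a (k + i) else 0 := fun j => by
      have hinj : Function.Injective fun i : ℕ => j + i := add_right_injective j
      have h1 := hinj.tsum_eq (f := fun i => if j ≤ i then a (k + i) else 0) fun i hi => by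
        rw [Function.mem_support, ite_ne_right_iff] at hi
        exact ⟨i - j, by simp only; omega⟩
      rw [← h1]
      simp [add_assoc]
    have hsum : ∀ j, Summable fun i => if j ≤ i then a (k + i) else 0 := fun j =>
      hka.of_nonneg_of_le (fun i => by split_ifs <;> simp [ha]) fun i => by
        split_ifs <;> simp [ha]
    calc ∑ j ∈ Finset.range N, b (k + j)
        ≤ ∑ j ∈ Finset.range N, ∑' i, if j ≤ i then a (k + i) else 0 :=
          Finset.sum_le_sum fun j _ => (hab _).trans_eq (htail j)
      _ = ∑' i, ∑ j ∈ Finset.range N, if j ≤ i then a (k + i) else 0 :=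
          (Summable.tsum_finsetSum fun j _ => hsum j).symm
      _ ≤ _ := (summable_sum fun j _ => hsum j).tsum_le_tsum (fun i => ?_) hs
    -- The term a (k + i) occurs once for each j ≤ i with j < N, at most i + 1 times.
    rw [← Finset.sum_filter, Finset.sum_const, nsmul_eq_mul]
    refine mul_le_mul_of_nonneg_right ?_ (ha _)
    have : (Finset.filter (fun j => j ≤ i) (Finset.range N)).card ≤ i + 1 := by
      rw [← Finset.card_range (i + 1)]
      exact Finset.card_le_card fun j hj => by
        rw [Finset.mem_filter] at hj
        exact Finset.mem_range.2 (by omega)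
    exact_mod_cast this
  exact ⟨summable_of_sum_range_le (fun _ => hb _) key,
    Real.tsum_le_of_sum_range_le (fun _ => hb _) key⟩

end TailSums

/-! ### Gram matrix tails as least squared residuals -/

section Gram

/-- A weighted sum of a decreasing nonnegative sequence with weights in `[0, 1]` of total mass at
most `m` is at most the sum of its first `m` terms. -/
theorem sum_mul_le_sum_head {N m : ℕ} (hm : m < N) {a p : Fin N → ℝ} (ha : Antitone a)
    (ha0 : ∀ i, 0 ≤ a i) (hp0 : ∀ i, 0 ≤ p i) (hp1 : ∀ i, p i ≤ 1) (hp : ∑ i, p i ≤ m) :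
    ∑ i, a i * p i ≤ ∑ i : Fin N, if (i : ℕ) < m then a i else 0 := by
  set c := a ⟨m, hm⟩ with hc
  -- Comparison at the threshold c = a m; after summation the correction is c (∑ p - m) ≤ 0.
  have h1 : ∀ i, a i * p i ≤ (if (i : ℕ) < m then a i else 0) +
      c * (p i - if (i : ℕ) < m then 1 else 0) := fun i => by
    split_ifs with hi
    · have : c ≤ a i := ha (Fin.le_def.2 hi.le)
      nlinarith [hp1 i]
    · have : a i ≤ c := ha (Fin.le_def.2 (not_lt.1 hi))
      nlinarith [hp0 i]
  have hcard : ∑ i : Fin N, (if (i : ℕ) < m then (1 : ℝ) else 0) = m := by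
    rw [Finset.sum_boole]
    have : (Finset.univ.filter fun i : Fin N => (i : ℕ) < m) = Finset.Iio ⟨m, hm⟩ := by
      ext i
      simp [Fin.lt_def]
    rw [this, Fin.card_Iio]
  refine (Finset.sum_le_sum fun i _ => h1 i).trans ?_
  rw [Finset.sum_add_distrib, ← Finset.mul_sum, Finset.sum_sub_distrib, hcard]
  nlinarith [ha0 ⟨m, hm⟩]

variable {S : Type*} [PseudoMetricSpace S] {H : Type*} [NormedAddCommGroup H]
  [InnerProductSpace ℝ H] {K : S → S → ℝ} (hK : IsMercerKernel K) {κ : C(S, H)}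
  (hκ : ∀ x y, inner ℝ (κ x) (κ y) = K x y) {n : ℕ}

include hκ in
theorem inner_sum_eigenvectorBasis (x : Fin n → S) (i j : Fin n) :
    inner ℝ (∑ l, (gramMatrix_isHermitian hK x).eigenvectorBasis i l • κ (x l))
        (∑ l, (gramMatrix_isHermitian hK x).eigenvectorBasis j l • κ (x l)) =
      if i = j then n * (gramMatrix_isHermitian hK x).eigenvalues j else 0 := by
  set hB := gramMatrix_isHermitian hK x
  set b := hB.eigenvectorBasis
  have hn : (n : ℝ) ≠ 0 := Nat.cast_ne_zero.2 (Fin.pos i).ne'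
  have hrow : ∀ s, ∑ l, b j l * K (x s) (x l) = n * (hB.eigenvalues j * b j s) := fun s => by
    have h1 := congrFun (hB.mulVec_eigenvectorBasis j) s
    simp only [Matrix.mulVec, dotProduct, gramMatrix, Matrix.of_apply, Pi.smul_apply,
      smul_eq_mul] at h1
    have h2 : ∑ l, 1 / (n : ℝ) * K (x s) (x l) * b j l = hB.eigenvalues j * b j s := h1
    rw [← h2, Finset.mul_sum]
    refine Finset.sum_congr rfl fun l _ => ?_
    field_simp
  have hort : ∑ s, b i s * b j s = if i = j then 1 else 0 := by
    rw [← orthonormal_iff_ite.1 b.orthonormal i j, PiLp.inner_apply]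
    simp [mul_comm]
  calc _ = ∑ s, b i s * ∑ l, b j l * K (x s) (x l) := by
        simp_rw [sum_inner, inner_sum, real_inner_smul_left, real_inner_smul_right, hκ,
          Finset.mul_sum]
    _ = n * hB.eigenvalues j * ∑ s, b i s * b j s := by
        rw [Finset.mul_sum]
        refine Finset.sum_congr rfl fun s _ => ?_
        rw [hrow]
        ring
    _ = _ := by
        rw [hort]
        simp

theorem sum_inner_sq_eq_sum_eigenvectorBasis (x : Fin n → S) (u : H) :
    ∑ l, inner ℝ u (κ (x l)) ^ 2 = ∑ i, inner ℝ u
      (∑ l, (gramMatrix_isHermitian hK x).eigenvectorBasis i l • κ (x l)) ^ 2 := by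
  set b := (gramMatrix_isHermitian hK x).eigenvectorBasis
  let c : EuclideanSpace ℝ (Fin n) := WithLp.toLp 2 fun l => inner ℝ u (κ (x l))
  have h1 := b.sum_sq_norm_inner_right c
  rw [EuclideanSpace.norm_sq_eq] at h1
  simp only [Real.norm_eq_abs, sq_abs] at h1
  rw [show ∑ l, inner ℝ u (κ (x l)) ^ 2 = ∑ l, c l ^ 2 from rfl, ← h1]
  refine Finset.sum_congr rfl fun i _ => ?_
  rw [inner_sum, PiLp.inner_apply]
  congr 1
  refine Finset.sum_congr rfl fun l _ => ?_
  simp [c, real_inner_smul_right, mul_comm]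

include hκ in
theorem nonneg_eigenvalues_gramMatrix (x : Fin n → S) (i : Fin n) :
    0 ≤ n * (gramMatrix_isHermitian hK x).eigenvalues i := by
  have h := inner_sum_eigenvectorBasis hK hκ x i i
  rw [if_pos rfl, real_inner_self_eq_norm_sq] at h
  rw [← h]
  positivity

include hκ in
/-- The singular value decomposition of the sampling operator attached to the points `x`. -/
theorem exists_gram_singularVec (x : Fin n → S) :
    ∃ w : Fin (Fintype.card (Fin n)) → H, IsSubOrthonormal w ∧
      (∀ i, 0 ≤ (gramMatrix_isHermitian hK x).eigenvalues₀ i) ∧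
      (∀ i, (gramMatrix_isHermitian hK x).eigenvalues₀ i * inner ℝ (w i) (w i) ^ 2 =
        (gramMatrix_isHermitian hK x).eigenvalues₀ i) ∧
      ∀ u, 1 / (n : ℝ) * ∑ l, inner ℝ u (κ (x l)) ^ 2 =
        ∑ i, (gramMatrix_isHermitian hK x).eigenvalues₀ i * inner ℝ u (w i) ^ 2 := by
  set hB := gramMatrix_isHermitian hK x with hhB
  let W : Fin n → H := fun i => ∑ l, hB.eigenvectorBasis i l • κ (x l)
  -- For a zero eigenvalue the inverse is 0 by convention, so w i = 0.
  let w : Fin n → H := fun i => (Real.sqrt (n * hB.eigenvalues i))⁻¹ • W i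
  have hnn : ∀ i, 0 ≤ n * hB.eigenvalues i := nonneg_eigenvalues_gramMatrix hK hκ x
  have hn : ∀ _ : Fin n, (0 : ℝ) < n := fun i => Nat.cast_pos.2 (Fin.pos i)
  have hW : ∀ i j, inner ℝ (W i) (W j) = if i = j then n * hB.eigenvalues j else 0 :=
    inner_sum_eigenvectorBasis hK hκ x
  have hw0 : ∀ i, hB.eigenvalues i = 0 → w i = 0 := fun i hi => by simp [w, hi]
  have hWw : ∀ i, W i = Real.sqrt (n * hB.eigenvalues i) • w i := fun i => by
    by_cases hi : hB.eigenvalues i = 0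
    · have h1 := hW i i
      rw [if_pos rfl, hi, mul_zero, inner_self_eq_zero] at h1
      rw [hw0 i hi, h1, smul_zero]
    · have h2 : Real.sqrt (n * hB.eigenvalues i) ≠ 0 :=
        Real.sqrt_ne_zero'.2 ((hnn i).lt_of_ne' (mul_ne_zero (hn i).ne' hi))
      simp only [w]
      rw [smul_smul, mul_inv_cancel₀ h2, one_smul]
  have hww : ∀ i, hB.eigenvalues i ≠ 0 → inner ℝ (w i) (w i) = 1 := fun i hi => by
    have h2 : n * hB.eigenvalues i ≠ 0 := mul_ne_zero (hn i).ne' hi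
    simp only [w]
    rw [real_inner_smul_left, real_inner_smul_right, hW, if_pos rfl, ← mul_assoc, ← mul_inv,
      Real.mul_self_sqrt (hnn i), inv_mul_cancel₀ h2]
  -- `eigenvalues` is by definition `eigenvalues₀` read through this equivalence.
  let q : Fin (Fintype.card (Fin n)) ≃ Fin n := Fintype.equivOfCardEq (Fintype.card_fin _)
  have hq : ∀ i, hB.eigenvalues (q i) = hB.eigenvalues₀ i := fun i => by
    change hB.eigenvalues₀ (q.symm (q i)) = _
    rw [Equiv.symm_apply_apply]
  have hsub : IsSubOrthonormal w := by
    refine ⟨fun i j hij => ?_, fun i => ?_⟩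
    · simp only [w]
      rw [real_inner_smul_left, real_inner_smul_right, hW, if_neg hij, mul_zero, mul_zero]
    · by_cases hi : hB.eigenvalues i = 0
      · rw [hw0 i hi, norm_zero]
        exact zero_le_one
      · have := hww i hi
        rw [real_inner_self_eq_norm_sq] at this
        nlinarith [norm_nonneg (w i)]
  refine ⟨w ∘ q, hsub.comp q.injective, fun i => ?_, fun i => ?_, fun u => ?_⟩
  · rw [← hq]
    exact nonneg_of_mul_nonneg_right (hnn _) (hn (q i))
  · rw [← hq]
    by_cases hi : hB.eigenvalues (q i) = 0
    · rw [hi, zero_mul]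
    · rw [Function.comp_apply, hww _ hi, one_pow, mul_one]
  · have h1 : ∀ i, 1 / (n : ℝ) * inner ℝ u (W i) ^ 2 = hB.eigenvalues i * inner ℝ u (w i) ^ 2 :=
      fun i => by
        have := (hn i).ne'
        rw [hWw, real_inner_smul_right, mul_pow, Real.sq_sqrt (hnn i)]
        field_simp
    rw [sum_inner_sq_eq_sum_eigenvectorBasis hK, Finset.mul_sum, ← q.sum_comp]
    refine Finset.sum_congr rfl fun i _ => ?_
    rw [← hq]
    exact h1 (q i)

include hκ in
theorem sum_eigenvalues₀_gramMatrix (x : Fin n → S) :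
    ∑ i, (gramMatrix_isHermitian hK x).eigenvalues₀ i =
      1 / (n : ℝ) * ∑ l, ‖κ (x l)‖ ^ 2 := by
  have h := (gramMatrix_isHermitian hK x).trace_eq_sum_eigenvalues
  simp only [Matrix.IsHermitian.eigenvalues, RCLike.ofReal_real_eq_id, id] at h
  rw [Equiv.sum_comp] at h
  rw [← h, Matrix.trace, Finset.mul_sum]
  refine Finset.sum_congr rfl fun l _ => ?_
  rw [← real_inner_self_eq_norm_sq, hκ]
  rfl

theorem gramTail_eq_sub (x : Fin n → S) (m : ℕ) :
    gramTail hK x m = ∑ i, (gramMatrix_isHermitian hK x).eigenvalues₀ i -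
      ∑ i : Fin (Fintype.card (Fin n)),
        if (i : ℕ) < m then (gramMatrix_isHermitian hK x).eigenvalues₀ i else 0 := by
  rw [gramTail, ← Finset.sum_sub_distrib]
  refine Finset.sum_congr rfl fun i _ => ?_
  by_cases hi : (i : ℕ) < m
  · rw [if_neg (not_le.2 hi), if_pos hi, sub_self]
  · rw [if_pos (not_lt.1 hi), if_neg hi, sub_zero]

/-- The average squared distance of the sampled feature vectors from the span of `e`, when `e` is
orthonormal. -/
noncomputable def meanResidual (κ : C(S, H)) {m : ℕ} (e : Fin m → H) (x : Fin n → S) : ℝ :=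
  1 / (n : ℝ) * ∑ l, (‖κ (x l)‖ ^ 2 - ∑ j, inner ℝ (e j) (κ (x l)) ^ 2)

theorem continuous_meanResidual {m : ℕ} (e : Fin m → H) :
    Continuous (meanResidual κ e : (Fin n → S) → ℝ) := by
  have h : ∀ l : Fin n, Continuous fun x : Fin n → S => κ (x l) := fun l =>
    κ.continuous.comp (continuous_apply l)
  exact continuous_const.mul (continuous_finsetSum _ fun l _ => ((h l).norm.pow 2).sub
    (continuous_finsetSum _ fun j _ => (continuous_const.inner (h l)).pow 2))

include hκ in
theorem meanResidual_eq_sub {m : ℕ} (e : Fin m → H) (x : Fin n → S)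
    {w : Fin (Fintype.card (Fin n)) → H}
    (hw : ∀ u, 1 / (n : ℝ) * ∑ l, inner ℝ u (κ (x l)) ^ 2 =
      ∑ i, (gramMatrix_isHermitian hK x).eigenvalues₀ i * inner ℝ u (w i) ^ 2) :
    meanResidual κ e x = ∑ i, (gramMatrix_isHermitian hK x).eigenvalues₀ i -
      ∑ i, (gramMatrix_isHermitian hK x).eigenvalues₀ i * ∑ j, inner ℝ (e j) (w i) ^ 2 := by
  rw [sum_eigenvalues₀_gramMatrix hK hκ, meanResidual, Finset.sum_sub_distrib, mul_sub,
    sub_right_inj, Finset.sum_comm, Finset.mul_sum]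
  simp_rw [hw, Finset.mul_sum]
  exact Finset.sum_comm

include hκ in
-- Ky Fan's principle: the residual is the trace minus ∑ λ_i p_i with p_i = ∑_j ⟨e_j, w_i⟩². Bessel
-- for e gives p_i ≤ 1, Bessel for w gives ∑ p_i ≤ m.
theorem gramTail_le_meanResidual {m : ℕ} (hm : m < n) {e : Fin m → H} (he : IsSubOrthonormal e)
    (x : Fin n → S) : gramTail hK x m ≤ meanResidual κ e x := by
  obtain ⟨w, hw, hnn, -, hsum⟩ := exists_gram_singularVec hK hκ x
  rw [gramTail_eq_sub, meanResidual_eq_sub hK hκ e x hsum]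
  have hone : ∀ {ι : Type} {v : ι → H}, IsSubOrthonormal v → ∀ i, ‖v i‖ ^ 2 ≤ 1 :=
    fun hv i => pow_le_one₀ (norm_nonneg _) (hv.norm_le_one i)
  refine sub_le_sub_left (sum_mul_le_sum_head (by simpa using hm)
    (gramMatrix_isHermitian hK x).eigenvalues₀_antitone hnn
    (fun i => Finset.sum_nonneg fun j _ => sq_nonneg _)
    (fun i => (he.sum_inner_sq_le _ _).trans (hone hw i)) ?_) _
  rw [Finset.sum_comm]
  calc ∑ j, ∑ i, inner ℝ (e j) (w i) ^ 2 ≤ ∑ _j : Fin m, (1 : ℝ) :=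
        Finset.sum_le_sum fun j _ => by
          simp_rw [real_inner_comm _ (e j)]
          exact (hw.sum_inner_sq_le _ _).trans (hone he j)
    _ = m := by simp

include hκ in
theorem exists_gramTail_eq_meanResidual {m : ℕ} (hm : m < n) (x : Fin n → S) :
    ∃ e : Fin m → H, IsSubOrthonormal e ∧ gramTail hK x m = meanResidual κ e x := by
  obtain ⟨w, hw, hnn, hself, hsum⟩ := exists_gram_singularVec hK hκ x
  have hmN : m < Fintype.card (Fin n) := by simpa using hm
  let g : Fin m → Fin (Fintype.card (Fin n)) := Fin.castLE hmN.le
  refine ⟨w ∘ g, hw.comp (Fin.castLE_injective hmN.le), ?_⟩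
  rw [gramTail_eq_sub, meanResidual_eq_sub hK hκ _ x hsum]
  congr 1
  refine Finset.sum_congr rfl fun i _ => ?_
  split_ifs with hi
  · rw [Finset.sum_eq_single ⟨i, hi⟩]
    · exact (hself i).symm
    · intro j _ hj
      rw [Function.comp_apply, hw.inner_eq_zero, sq, mul_zero]
      exact fun h => hj (Fin.ext (congrArg Fin.val h :))
    · simp
  · rw [Finset.sum_eq_zero, mul_zero]
    intro j _
    rw [Function.comp_apply, hw.inner_eq_zero, sq, mul_zero]
    rintro rfl
    exact hi j.2

include hκ in
-- A pointwise minimum of continuous residuals; this yields measurability of the tail.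
theorem upperSemicontinuous_gramTail {m : ℕ} (hm : m < n) :
    UpperSemicontinuous fun x : Fin n → S => gramTail hK x m := by
  intro x c hc
  obtain ⟨e, he, hex⟩ := exists_gramTail_eq_meanResidual hK hκ hm x
  have hc' : meanResidual κ e x < c := hex ▸ hc
  filter_upwards [(continuous_meanResidual e).continuousAt.eventually_lt_const hc'] with y hy
  exact (gramTail_le_meanResidual hK hκ hm he y).trans_lt hy

include hκ in
theorem gramTail_nonneg (x : Fin n → S) (m : ℕ) : 0 ≤ gramTail hK x m := by
  obtain ⟨w, -, hnn, -⟩ := exists_gram_singularVec hK hκ x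
  refine Finset.sum_nonneg fun i _ => ?_
  split_ifs
  exacts [hnn i, le_rfl]

/-! ### Expectation of the Gram tail -/

variable [CompactSpace S] [MeasurableSpace S] [BorelSpace S]
  {Ω : Type*} [MeasurableSpace Ω] {Q : Measure Ω} [IsFiniteMeasure Q] {Z : Fin n → Ω → S}

theorem integral_meanResidual {m : ℕ} (hn : n ≠ 0) (e : Fin m → H) {ρ : Measure S}
    [IsFiniteMeasure ρ] (hZ : ∀ i, HasLaw (Z i) ρ Q) :
    ∫ ω, meanResidual κ e (fun i => Z i ω) ∂Q =
      ∫ x, ‖κ x‖ ^ 2 ∂ρ - ∑ j, ‖featureOp κ ρ (e j)‖ ^ 2 := by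
  let g : S → ℝ := fun x => ‖κ x‖ ^ 2 - ∑ j, inner ℝ (e j) (κ x) ^ 2
  have hg : Continuous g := (κ.continuous.norm.pow 2).sub
    (continuous_finsetSum _ fun j _ => (continuous_const.inner κ.continuous).pow 2)
  have hint : ∀ l, Integrable (fun ω => g (Z l ω)) Q := fun l => by
    obtain ⟨C, hC⟩ := (isCompact_range hg.norm).bddAbove
    exact Integrable.of_bound
      (hg.measurable.comp_aemeasurable (hZ l).aemeasurable).aestronglyMeasurable C
      (Eventually.of_forall fun ω => hC ⟨Z l ω, rfl⟩)
  have hcomp : ∀ l, ∫ ω, g (Z l ω) ∂Q = ∫ x, g x ∂ρ := fun l =>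
    (hZ l).integral_comp hg.aestronglyMeasurable
  change ∫ ω, 1 / (n : ℝ) * ∑ l, g (Z l ω) ∂Q = _
  rw [integral_const_mul, integral_finsetSum _ fun l _ => hint l]
  simp_rw [hcomp, norm_sq_featureOp]
  rw [Finset.sum_const, Finset.card_univ, Fintype.card_fin, nsmul_eq_mul, ← mul_assoc,
    one_div_mul_cancel (Nat.cast_ne_zero.2 hn), one_mul,
    ← integral_finsetSum _ fun j _ => integrable_inner_sq (e j) ρ]
  exact integral_sub (integrable_of_continuous (κ.continuous.norm.pow 2) ρ)
    (integrable_finsetSum _ fun j _ => integrable_inner_sq (e j) ρ)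

variable [SecondCountableTopology S]

theorem integrable_meanResidual {m : ℕ} (e : Fin m → H) (hZ : ∀ i, AEMeasurable (Z i) Q) :
    Integrable (fun ω => meanResidual κ e fun i => Z i ω) Q := by
  obtain ⟨C, hC⟩ := (isCompact_range (continuous_meanResidual (n := n) (κ := κ) e).norm).bddAbove
  exact Integrable.of_bound ((continuous_meanResidual e).measurable.comp_aemeasurable
    (aemeasurable_pi_lambda _ hZ)).aestronglyMeasurable C
    (Eventually.of_forall fun ω => hC ⟨fun i => Z i ω, rfl⟩)

include hκ in
theorem integrable_gramTail {m : ℕ} (hm : m < n) (hZ : ∀ i, AEMeasurable (Z i) Q) :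
    Integrable (fun ω => gramTail hK (fun i => Z i ω) m) Q := by
  -- The zero family is admissible; its residual, the mean of ‖κ‖² over the sample, dominates the
  -- tail.
  refine (integrable_meanResidual (κ := κ) (fun _ : Fin m => (0 : H)) hZ).mono'
    ((upperSemicontinuous_gramTail hK hκ hm).measurable.comp_aemeasurable
      (aemeasurable_pi_lambda _ hZ)).aestronglyMeasurable (Eventually.of_forall fun ω => ?_)
  rw [Real.norm_of_nonneg (gramTail_nonneg hK hκ _ m)]
  exact gramTail_le_meanResidual hK hκ hm ⟨by simp, by simp⟩ _

include hκ in
theorem integral_gramTail_le [CompleteSpace H] {m : ℕ} (hm : m < n) {ρ : Measure S}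
    [IsFiniteMeasure ρ] (hZ : ∀ i, HasLaw (Z i) ρ Q) {lamρ : ℕ → ℝ} {psi : ℕ → Lp ℝ 2 ρ}
    (h : IsEigensystem (featureOp κ ρ ∘L (featureOp κ ρ).adjoint : Lp ℝ 2 ρ →L[ℝ] Lp ℝ 2 ρ)
      lamρ psi) :
    ∫ ω, gramTail hK (fun i => Z i ω) m ∂Q ≤ ∑' j, lamρ (m + j) := by
  let e : Fin m → H := fun j => singularVec (featureOp κ ρ) lamρ psi j
  have he : IsSubOrthonormal e := h.isSubOrthonormal_singularVec.comp Fin.val_injective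
  have hZ' := fun i => (hZ i).aemeasurable
  calc ∫ ω, gramTail hK (fun i => Z i ω) m ∂Q
      ≤ ∫ ω, meanResidual κ e (fun i => Z i ω) ∂Q :=
        integral_mono (integrable_gramTail hK hκ hm hZ') (integrable_meanResidual e hZ')
          fun ω => gramTail_le_meanResidual hK hκ hm he _
    _ = ∑' j, lamρ (m + j) := by
        have htr := h.hasSum_eigenvalues
        rw [integral_meanResidual (by omega) e hZ, ← htr.tsum_eq,
          ← htr.summable.sum_add_tsum_nat_add m, sub_eq_iff_eq_add', ← Fin.sum_univ_eq_sum_range]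
        simp only [e, h.norm_sq_apply_singularVec, add_comm m]

end Gram

end KernelSpectrum

/-- All sequences are indexed from `0`: `lam j`, `phi j`, `lamρ j` are the `(j+1)`-st eigenvalue
and eigenfunction for `P` and the `(j+1)`-st eigenvalue for `ρ`. -/
theorem theorem1 {d : ℕ} (X : Set (EuclideanSpace ℝ (Fin d))) [CompactSpace X]
    (K : X → X → ℝ) (hK : KernelSpectrum.IsMercerKernel K)
    (P ρ : Measure X) [IsProbabilityMeasure P] [IsProbabilityMeasure ρ]
    (H0 : Function.Injective (KernelSpectrum.kernelOp hK P))
    (H1 : ρ ≪ P ∧ ∃ M : NNReal, ∀ᵐ x ∂P, ρ.rnDeriv P x ≤ M)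
    (lam : ℕ → ℝ) (phi : ℕ → Lp ℝ 2 P)
    (hP : KernelSpectrum.IsEigensystem (KernelSpectrum.kernelOp hK P) lam phi)
    (lamρ : ℕ → ℝ)
    (hρ : KernelSpectrum.IsEigenvalueSeq (KernelSpectrum.kernelOp hK ρ) lamρ) :
    (∀ m : ℕ,
      Summable (fun j : ℕ => lam (m + j) * KernelSpectrum.sqNorm ρ (phi (m + j))) ∧
      lamρ m ≤ ∑' j : ℕ, lam (m + j) * KernelSpectrum.sqNorm ρ (phi (m + j))) ∧
    (∀ (n k : ℕ), k < n →
      ∀ {Ω : Type*} [MeasurableSpace Ω] (Q : Measure Ω) [IsProbabilityMeasure Q]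
        (Z : Fin n → Ω → X), (∀ i, HasLaw (Z i) ρ Q) → iIndepFun Z Q →
      Integrable (fun ω => KernelSpectrum.gramTail hK (fun i => Z i ω) k) Q ∧
      Summable (fun j : ℕ => lamρ (k + j)) ∧
      ∫ ω, KernelSpectrum.gramTail hK (fun i => Z i ω) k ∂Q ≤ ∑' j : ℕ, lamρ (k + j)) ∧
    (∀ k : ℕ,
      0 < lam k * KernelSpectrum.sqNorm ρ (phi k) →
      Summable (fun i : ℕ => ((i : ℝ) + 1) * lam (k + i) * KernelSpectrum.sqNorm ρ (phi (k + i)) /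
        (lam k * KernelSpectrum.sqNorm ρ (phi k))) →
      Summable (fun j : ℕ => lamρ (k + j)) ∧
      ∑' j : ℕ, lamρ (k + j) ≤
        (∑' i : ℕ, ((i : ℝ) + 1) * lam (k + i) * KernelSpectrum.sqNorm ρ (phi (k + i)) /
          (lam k * KernelSpectrum.sqNorm ρ (phi k))) *
        (lam k * KernelSpectrum.sqNorm ρ (phi k))) := by
  obtain ⟨H, _, _, _, κ, hκ⟩ := hK.exists_featureMap
  rw [KernelSpectrum.kernelOp_eq_comp_adjoint hK hκ] at hP hρ
  obtain ⟨psi, hpsi⟩ := hρ.exists_isEigensystem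
    ((KernelSpectrum.isCompactOperator_featureOp κ ρ).comp_clm _)
    (KernelSpectrum.isSymmetric_comp_adjoint _)
  have hnorm := hP.norm_sq_featureOp_singularVec H1.1
  have hnonneg : ∀ j, 0 ≤ lam j * KernelSpectrum.sqNorm ρ (phi j) := fun j => by
    rw [← hnorm]
    positivity
  have hle : ∀ m, lamρ m ≤ ∑' j, lam (m + j) * KernelSpectrum.sqNorm ρ (phi (m + j)) :=
    fun m => by
      have h := hP.le_tsum_norm_sq_featureOp_singularVec hpsi H1.1 m
      simpa only [hnorm] using h
  refine ⟨fun m => ⟨?_, hle m⟩, ?_, ?_⟩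
  · have h := (hP.isSubOrthonormal_singularVec.comp
      (add_right_injective m)).summable_norm_sq_featureOp (k := κ) ρ
    simpa only [Function.comp_apply, hnorm] using h
  · intro n k hkn Ω _ Q _ Z hZ _
    exact ⟨KernelSpectrum.integrable_gramTail hK hκ hkn fun i => (hZ i).aemeasurable,
      hpsi.hasSum_eigenvalues.summable.comp_injective (add_right_injective k),
      KernelSpectrum.integral_gramTail_le hK hκ hkn hZ hpsi⟩
  · intro k hk hs
    -- Multiplying by the positive leading term undoes the normalization in S_k.
    have hs' := hs.mul_right (lam k * KernelSpectrum.sqNorm ρ (phi k))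
    rw [← tsum_mul_right]
    simp only [div_mul_cancel₀ _ hk.ne', mul_assoc] at hs' ⊢
    exact KernelSpectrum.summable_and_tsum_le_of_le_tail hnonneg hρ.nonneg hle k hs'
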